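/- **Definitions.** A labeled poset $(P,\omega)$ is a finite nonempty poset $P$, $p=|P|$, with an injection $\omega:P\to\mathbb Z$. $\mathcal L(P,\omega)$ is the set of permutations $\pi=a_1a_2\cdots a_p$ of the label set $\omega(P)$ such that $\omega(x)$ precedes $\omega(y)$ in $\pi$ whenever $x<_P y$. Let $\mathrm{des}(\pi)=|\{1\le i<p: a_i>a_{i+1}\}|$ and $\mathrm{peak}(\pi)=|\{1\le i\le p: a_{i-1}<a_i>a_{i+1}\}|$ with the convention $a_0=a_{p+1}=0$, and put $$W(P,\omega;t)=\sum_{\pi\in\mathcal L(P,\omega)}t^{\mathrm{des}(\pi)},\qquad \overline W(P,\omega;t)=\sum_{\pi\in\mathcal L(P,\omega)}t^{\mathrm{peak}(\pi)}.$$ For a covering relation $x\lessdot y$ let $\epsilon(x,y)=1$ if $\omega(x)<\omega(y)$ and $\epsilon(x,y)=-1$ if $\omega(x)>\omega(y)$. $(P,\omega)$ is sign-graded of rank $r$ if the sum of the signs $\epsilon$ along every maximal chain equals $r$; its rank function $\rho(x)$ is the sum of the signs along any saturated chain from a minimal element to $x$. The labeling $\omega$ is canonical if $(P,\omega)$ is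 sign-graded, $\rho$ has values in $\{0,1\}$, the elements with $\rho=0$ have negative labels and the elements with $\rho=1$ have positive labels. Let $\hat P$ be $P$ with a new greatest element adjoined, and let $\hat\omega$ denote a canonical labeling of $\hat P$. **Theorem.** Let $(P,\omega)$ be a canonically labeled sign-graded poset of rank $r$ (so $r\in\{0,1\}$), and let $d=p-r-1$. There are unique integers $a_i(P,\omega)$, $0\le i\le\lfloor d/2\rfloor$, such that $$W(P,\omega;t)=\sum_{i=0}^{\lfloor d/2\rfloor}a_i(P,\omega)\,t^i(1+t)^{d-2i},$$ and they are nonnegative. Moreover: (a) If $r=0$, then $W(P,\omega;t)=2^{-p+1}(1+t)^{p-1}\,\overline W\big(P,\omega;4t(1+t)^{-2}\big)$ and, for $0\le i\le\lfloor d/2\rfloor$, $$a_i(P,\omega)=2^{-p+1+2i}\,\big|\{\pi\in\mathcal L(P,\omega):\mathrm{peak}(\pi)=i\}\big|.$$ (b) If $r=1$, then $\hat P$ has a canonical labeling, and for every canonical labeling $\hat\omega$ of $\hat P$ one has $W(P,\omega;t)=2^{-p}t^{-1}(1+t)^{p}\,\overline W\big(\hat P,\hat\omega;4t(1+t)^{-2}\big)$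 and, for $0\le i\le\lfloor d/2\rfloor$, $$a_i(P,\omega)=2^{-p+2+2i}\,\big|\{\pi\in\mathcal L(\hat P,\hat\omega):\mathrm{peak}(\pi)=i+1\}\big|.$$ -/

import Mathlib

open Polynomial

/-!
### Labeled posets, signs, sign-graded posets

A labeled poset is a finite partial order `P` with an injective labeling `ω : P → ℤ`.
-/

section Signs

variable {P : Type*} [PartialOrder P]

/-- The sign `ε(x, y)` of an edge `x ⋖ y` of the Hasse diagram of `(P, ω)`. -/
def edgeSign (ω : P → ℤ) (x y : P) : ℤ := if ω x < ω y then 1 else -1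

/-- The sum of the signs of consecutive pairs in a chain `x₁ < x₂ < ⋯ < x_k`. -/
def signSum (ω : P → ℤ) : List P → ℤ
  | x :: y :: l => edgeSign ω x y + signSum ω (y :: l)
  | _ => 0

/-- `l` is a saturated chain `x₁ ⋖ x₂ ⋖ ⋯ ⋖ x_k = x` (`k ≥ 1`) from a minimal element of the
poset to `x`. -/
def IsSaturatedChainTo (l : List P) (x : P) : Prop :=
  l.IsChain (· ⋖ ·) ∧ (∃ m : P, IsMin m ∧ l.head? = some m) ∧ l.getLast? = some x

/-- Maximal chains of a finite poset: saturated chains that begin in a minimal element and end in a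
maximal element. -/
def IsMaximalChain (l : List P) : Prop :=
  ∃ x : P, IsMax x ∧ IsSaturatedChainTo l x

/-- `(P, ω)` is sign-graded of rank `r`: along every maximal chain the sum of the signs is `r`. -/
def IsSignGradedOfRank (ω : P → ℤ) (r : ℤ) : Prop :=
  ∀ l : List P, IsMaximalChain l → signSum ω l = r

/-- `ρ` is the (generalized) rank function of `(P, ω)`: `ρ x` is the sum of the signs along any
saturated chain from a minimal element to `x`. -/
def IsRankFunction (ω : P → ℤ) (ρ : P → ℤ) : Prop :=
  ∀ (l : List P) (x : P), IsSaturatedChainTo l x → signSum ω l = ρ x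

/-- `ω` is a canonical labeling of `P`: `(P, ω)` is a sign-graded labeled poset, its rank function
has values in `{0, 1}`, elements of rank `0` have negative labels and elements of rank `1` have
positive labels. -/
structure IsCanonicalLabeling (ω : P → ℤ) : Prop where
  injective : Function.Injective ω
  signGraded : ∃ r : ℤ, IsSignGradedOfRank ω r
  rank : ∃ ρ : P → ℤ, IsRankFunction ω ρ ∧ (∀ x, ρ x = 0 ∨ ρ x = 1) ∧
    (∀ x, ρ x = 0 → ω x < 0) ∧ (∀ x, ρ x = 1 → 0 < ω x)

end Signs

/-!
### Descents and peaks of words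
-/

/-- The number of descents `aᵢ > aᵢ₊₁` of the word `a₁ a₂ ⋯ a_n`. -/
def descentCount : List ℤ → ℕ
  | a :: b :: l => (if b < a then 1 else 0) + descentCount (b :: l)
  | _ => 0

/-- The number of consecutive triples `a < b > c` in a word. -/
def innerPeakCount : List ℤ → ℕ
  | a :: b :: c :: l => (if a < b ∧ c < b then 1 else 0) + innerPeakCount (b :: c :: l)
  | _ => 0

/-- The number of peaks `aᵢ₋₁ < aᵢ > aᵢ₊₁`, `1 ≤ i ≤ n`, of the word `a₁ a₂ ⋯ a_n`, where
`a₀ = a_{n+1} = 0`. -/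
def peakCount (π : List ℤ) : ℕ := innerPeakCount (0 :: (π ++ [0]))

/-!
### The Jordan–Hölder set and its polynomials
-/

section Polynomials

variable {P : Type*} [PartialOrder P] [Fintype P]

open Classical in
/-- The Jordan–Hölder set `𝓛(P, ω)`: the permutations (as words) of the label set `ω(P)` in which
`ω x` precedes `ω y` whenever `x < y` in `P`. -/
noncomputable def jordanHolderSet (ω : P → ℤ) : Finset (List ℤ) :=
  (Finset.univ.image ω).val.lists.toFinset.filter
    fun π => ∀ x y : P, x < y → π.idxOf (ω x) < π.idxOf (ω y)

/-- The `(P, ω)`-Eulerian polynomial `W(P, ω; t)`. -/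
noncomputable def eulerianPoly (ω : P → ℤ) : ℤ[X] :=
  ∑ π ∈ jordanHolderSet ω, X ^ descentCount π

/-- The peak polynomial `W̄(P, ω; t)`. -/
noncomputable def peakPoly (ω : P → ℤ) : ℤ[X] :=
  ∑ π ∈ jordanHolderSet ω, X ^ peakCount π

/-- The number of `π ∈ 𝓛(P, ω)` with exactly `i` peaks. -/
noncomputable def numWithPeaks (ω : P → ℤ) (i : ℕ) : ℕ :=
  ((jordanHolderSet ω).filter fun π => peakCount π = i).card

/-- `d = p - r - 1`, where `p = |P|`. -/
def eulerianDegree (P : Type*) [Fintype P] (r : ℤ) : ℕ :=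
  ((Fintype.card P : ℤ) - r - 1).toNat

/-- The integers `a 0, …, a ⌊d/2⌋` are the coefficients `aᵢ(P, ω)` in the expansion
`W(P, ω; t) = ∑_{i ≤ ⌊d/2⌋} aᵢ tⁱ (1 + t)^(d - 2i)`, where `d = p - r - 1`. -/
def IsEulerianExpansion (ω : P → ℤ) (r : ℤ) (a : ℕ → ℤ) : Prop :=
  eulerianPoly ω =
    ∑ i ∈ Finset.range (eulerianDegree P r / 2 + 1),
      C (a i) * X ^ i * (1 + X) ^ (eulerianDegree P r - 2 * i)

end Polynomials

/-!
### Weights of words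
-/

section Words

/-! Border each word with zeros and weight a peak by `p`, a valley by `q`, a double ascent by `u`, a
double descent by `v`. The crux is that the total weight of the linear extensions depends on `u` and
`v` only through `u + v`, and on the labeling only through the signs of the labels.

In a canonical labeling the signs alternate along covers, so neighbouring letters of equal sign in a
linear extension are incomparable and may be exchanged (`IsAlternating.swapClosed`). The linear
extensions thus fall into classes: fix the sequence of maximal runs of equal sign, and arrange each
run freely. A neighbour of opposite sign acts like a border zero, so the weight is a product over
runs (`wordWeight_append`). Inside a run, cut at the letter closest to zero: it is a double ascent
or double descent exactly when one side is empty and the other is not, and these two cases together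
give `u + v` (`runWeight_congr`).

Up to a factor `X ^ r`, W has weights `(p, q, u, v) = (X, 1, 1, X)`, which may be replaced by `(X,
1, 1 + X, 0)`; the peak polynomial has `(X, 1, 1, 1)`, replaceable by `(X, 1, 2, 0)`. With `v = 0`
only words without double descents survive, and both polynomials expand with the same numbers
`gammaCoeff`. This gives nonnegativity and both identities. For rank 1, the negative greatest
element of P̂ ends every word without changing its peaks. -/

/-- The number of consecutive triples `a ≥ b ≤ c` in a word. -/
def innerValleyCount : List ℤ → ℕ
  | a :: b :: c :: l => (if ¬ a < b ∧ ¬ c < b then 1 else 0) + innerValleyCount (b :: c :: l)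
  | _ => 0

/-- The number of consecutive triples `a < b ≤ c` in a word. -/
def doubleAscentCount : List ℤ → ℕ
  | a :: b :: c :: l => (if a < b ∧ ¬ c < b then 1 else 0) + doubleAscentCount (b :: c :: l)
  | _ => 0

/-- The number of consecutive triples `a ≥ b > c` in a word. -/
def doubleDescentCount : List ℤ → ℕ
  | a :: b :: c :: l => (if ¬ a < b ∧ c < b then 1 else 0) + doubleDescentCount (b :: c :: l)
  | _ => 0

variable {A : Type*} [CommRing A]

/-- The weight of the letter `b` between its neighbours `a` and `c`: `p` for a peak, `q` for a
valley, `u` for a double ascent, `v` for a double descent. -/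
def letterWeight (p q u v : A) (a b c : ℤ) : A :=
  if a < b then (if c < b then p else u) else (if c < b then v else q)

/-- The product of the weights of the inner letters of a word. -/
def innerWeight (p q u v : A) : List ℤ → A
  | a :: b :: c :: l => letterWeight p q u v a b c * innerWeight p q u v (b :: c :: l)
  | _ => 1

/-- The product of the weights of the letters of a word that is bordered by zeros. -/
def wordWeight (p q u v : A) (π : List ℤ) : A := innerWeight p q u v (0 :: (π ++ [0]))

theorem innerWeight_eq (p q u v : A) : ∀ w : List ℤ,
    innerWeight p q u v w = p ^ innerPeakCount w * q ^ innerValleyCount w *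
      u ^ doubleAscentCount w * v ^ doubleDescentCount w
  | [] => by simp [innerWeight, innerPeakCount, innerValleyCount, doubleAscentCount,
      doubleDescentCount]
  | [_] => by simp [innerWeight, innerPeakCount, innerValleyCount, doubleAscentCount,
      doubleDescentCount]
  | [_, _] => by simp [innerWeight, innerPeakCount, innerValleyCount, doubleAscentCount,
      doubleDescentCount]
  | a :: b :: c :: l => by
      rw [innerWeight, innerWeight_eq p q u v (b :: c :: l), innerPeakCount, innerValleyCount,
        doubleAscentCount, doubleDescentCount, letterWeight]
      by_cases h₁ : a < b <;> by_cases h₂ : c < b <;> simp [h₁, h₂, pow_add] <;> ring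

/-- A letter followed by a smaller one is a peak or a double descent; the leading `a` serves only as
a left neighbour. -/
theorem innerPeakCount_add_doubleDescentCount : ∀ (a : ℤ) (w : List ℤ),
    innerPeakCount (a :: w) + doubleDescentCount (a :: w) = descentCount w
  | _, [] => by simp [innerPeakCount, doubleDescentCount, descentCount]
  | _, [_] => by simp [innerPeakCount, doubleDescentCount, descentCount]
  | a, b :: c :: l => by
      have := innerPeakCount_add_doubleDescentCount b (c :: l)
      rw [innerPeakCount, doubleDescentCount, descentCount]
      by_cases h₁ : a < b <;> by_cases h₂ : c < b <;> simp [h₁, h₂] <;> omega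

theorem innerCount_total : ∀ (a b : ℤ) (w : List ℤ),
    innerPeakCount (a :: b :: w) + innerValleyCount (a :: b :: w) +
      doubleAscentCount (a :: b :: w) + doubleDescentCount (a :: b :: w) = w.length
  | _, _, [] => by simp [innerPeakCount, innerValleyCount, doubleAscentCount, doubleDescentCount]
  | a, b, c :: l => by
      have := innerCount_total b c l
      rw [innerPeakCount, doubleDescentCount, innerValleyCount, doubleAscentCount]
      by_cases h₁ : a < b <;> by_cases h₂ : c < b <;> simp [h₁, h₂] <;> omega

/-- Peaks and valleys alternate, so their difference is fixed by the directions of the first step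
and of the last step, from `z` to 0. Distinct nonzero letters exclude flat steps, which would break
the alternation. -/
theorem innerValleyCount_add_first (a b z : ℤ) (l : List ℤ) (hn : (b :: l).Nodup)
    (h0 : (0 : ℤ) ∉ b :: l) (hz : (b :: l).getLast (List.cons_ne_nil b l) = z) :
    innerValleyCount (a :: ((b :: l) ++ [0])) + (if a < b then 1 else 0) =
      innerPeakCount (a :: ((b :: l) ++ [0])) + (if z < 0 then 1 else 0) := by
  induction l generalizing a b with
  | nil =>
    have : (0 : ℤ) ≠ b := by simpa using h0
    obtain rfl : b = z := hz
    simp only [List.cons_append, List.nil_append, innerValleyCount, innerPeakCount]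
    split_ifs <;> omega
  | cons c l ih =>
    have := ih b c hn.of_cons (fun h => h0 (List.mem_cons_of_mem _ h)) hz
    have hbc : b ≠ c := fun h => by simp [h] at hn
    simp only [List.cons_append, innerValleyCount, innerPeakCount] at this ⊢
    split_ifs at this ⊢ <;> omega

theorem descentCount_append_zero (b z : ℤ) (l : List ℤ)
    (hz : (b :: l).getLast (List.cons_ne_nil b l) = z) :
    descentCount ((b :: l) ++ [0]) = descentCount (b :: l) + (if 0 < z then 1 else 0) := by
  induction l generalizing b with
  | nil =>
    obtain rfl : b = z := hz
    simp [descentCount]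
  | cons c l ih =>
    have := ih c hz
    simp only [List.cons_append, descentCount] at this ⊢
    omega

/-- The factors overlap in `a, b`, so each consecutive triple lies in exactly one of them. -/
theorem innerWeight_append (p q u v : A) (a b : ℤ) (r : List ℤ) : ∀ l : List ℤ,
    innerWeight p q u v (l ++ a :: b :: r) =
      innerWeight p q u v (l ++ [a, b]) * innerWeight p q u v (a :: b :: r)
  | [] => by simp [innerWeight]
  | [x] => by simp [innerWeight]
  | [x, y] => by simp [innerWeight, mul_assoc]
  | x :: y :: z :: l => by
      have := innerWeight_append p q u v a b r (y :: z :: l)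
      simp only [List.cons_append, innerWeight] at this ⊢
      rw [this, mul_assoc]

/-- The weight of a word is multiplicative at a place where the sign of the letters changes. -/
theorem wordWeight_append (p q u v : A) (l r : List ℤ) (a b : ℤ)
    (hab : a < 0 ∧ 0 < b ∨ b < 0 ∧ 0 < a) :
    wordWeight p q u v ((l ++ [a]) ++ (b :: r)) =
      wordWeight p q u v (l ++ [a]) * wordWeight p q u v (b :: r) := by
  obtain ⟨z, l', hl⟩ : ∃ z l', (0 : ℤ) :: l = l' ++ [z] :=
    ⟨_, _, (List.dropLast_append_getLast (List.cons_ne_nil 0 l)).symm⟩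
  obtain ⟨c, r', hr⟩ : ∃ c r', r ++ [(0 : ℤ)] = c :: r' := by
    cases r <;> simp
  have e1 : (0 : ℤ) :: (((l ++ [a]) ++ (b :: r)) ++ [0]) = l' ++ z :: a :: b :: c :: r' := by
    calc _ = ((0 : ℤ) :: l) ++ a :: b :: (r ++ [0]) := by simp
      _ = _ := by rw [hl, hr]; simp
  have e2 : (0 : ℤ) :: ((l ++ [a]) ++ [0]) = l' ++ [z, a, 0] := by
    calc _ = ((0 : ℤ) :: l) ++ [a, 0] := by simp
      _ = _ := by rw [hl]; simp
  have e3 : (0 : ℤ) :: ((b :: r) ++ [0]) = 0 :: b :: c :: r' := by simp [hr]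
  rw [wordWeight, wordWeight, wordWeight, e1, e2, e3, innerWeight_append,
    innerWeight_append p q u v z a [0]]
  simp only [innerWeight, letterWeight]
  -- Seen from `a`, the letter `b` lies on the same side as 0, and conversely, so each may be
  -- replaced by a border zero.
  rcases hab with ⟨h₁, h₂⟩ | ⟨h₁, h₂⟩
  · simp [h₂, h₁.trans h₂, (h₁.trans h₂).not_gt, h₁.not_gt, mul_assoc]
  · simp [h₂, h₁.trans h₂, (h₁.trans h₂).not_gt, h₁.not_gt, mul_assoc]

theorem innerWeight_congr_last (p q u v : A) (l : List ℤ) (a b c : ℤ) (h : c < b ↔ a < b) :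
    innerWeight p q u v (l ++ [b, c]) = innerWeight p q u v (l ++ [b, a]) := by
  rcases List.eq_nil_or_concat l with rfl | ⟨l, z, rfl⟩
  · simp [innerWeight]
  · have := fun c => innerWeight_append p q u v z b [c] l
    simp only [List.append_assoc, List.cons_append, List.nil_append, List.concat_eq_append] at this ⊢
    rw [this, this]
    simp [innerWeight, letterWeight, h]

theorem innerWeight_congr_head (p q u v : A) (l : List ℤ) (a b c : ℤ) (h : c < b ↔ a < b) :
    innerWeight p q u v (c :: b :: l) = innerWeight p q u v (a :: b :: l) := by
  cases l <;> simp [innerWeight, letterWeight, h]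

/-- The weight of a word with letters of one sign factors at the letter `x` closest to zero. -/
theorem wordWeight_append_cons (p q u v : A) (s : ℤ) (l r : List ℤ) (x : ℤ)
    (h : s = 1 ∧ 0 < x ∧ (∀ y ∈ l ++ r, x < y) ∨ s = -1 ∧ x < 0 ∧ (∀ y ∈ l ++ r, y < x)) :
    wordWeight p q u v (l ++ x :: r) =
      letterWeight p q u v (if l.length = 0 then 0 else 2 * s) s
        (if r.length = 0 then 0 else 2 * s) *
      (wordWeight p q u v l * wordWeight p q u v r) := by
  -- The left neighbour `z` of `x` is the border zero or a letter farther out than `x`, modelled by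
  -- 0 or `2 * s` against `s`. Seen from `l`, the letter `x` compares like the border zero.
  have hl : ∃ z l', (0 : ℤ) :: l = l' ++ [z] ∧
      (z < x ↔ (if l.length = 0 then 0 else 2 * s) < s) ∧
      innerWeight p q u v ((0 : ℤ) :: (l ++ [x])) = wordWeight p q u v l := by
    rcases List.eq_nil_or_concat l with rfl | ⟨l, z, rfl⟩
    · refine ⟨0, [], rfl, ?_, by simp [wordWeight, innerWeight]⟩; simp; omega
    · have hz : (s = 1 ∧ 0 < x ∧ x < z) ∨ (s = -1 ∧ x < 0 ∧ z < x) := by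
        rcases h with ⟨h1, h2, h3⟩ | ⟨h1, h2, h3⟩
        · exact .inl ⟨h1, h2, h3 z (by simp)⟩
        · exact .inr ⟨h1, h2, h3 z (by simp)⟩
      refine ⟨z, 0 :: l, by simp, ?_, ?_⟩
      · simp; omega
      · have := innerWeight_congr_last p q u v (0 :: l) 0 z x (by omega)
        simpa [wordWeight] using this
  have hr : ∃ c r', r ++ [(0 : ℤ)] = c :: r' ∧ (c < x ↔ (if r.length = 0 then 0 else 2 * s) < s) ∧
      innerWeight p q u v (x :: (r ++ [0])) = wordWeight p q u v r := by
    cases r with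
    | nil => refine ⟨0, [], rfl, ?_, by simp [wordWeight, innerWeight]⟩; simp; omega
    | cons c r =>
      have hz : (s = 1 ∧ 0 < x ∧ x < c) ∨ (s = -1 ∧ x < 0 ∧ c < x) := by
        rcases h with ⟨h1, h2, h3⟩ | ⟨h1, h2, h3⟩
        · exact .inl ⟨h1, h2, h3 c (by simp)⟩
        · exact .inr ⟨h1, h2, h3 c (by simp)⟩
      refine ⟨c, r ++ [0], by simp, by simp; omega, ?_⟩
      have := innerWeight_congr_head p q u v (r ++ [0]) 0 c x (by omega)
      simpa [wordWeight] using this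
  obtain ⟨z, l', hl, hz, hwl⟩ := hl
  obtain ⟨c, r', hr, hc, hwr⟩ := hr
  have e1 : (0 : ℤ) :: ((l ++ x :: r) ++ [0]) = l' ++ z :: x :: c :: r' := by
    calc _ = ((0 : ℤ) :: l) ++ x :: (r ++ [0]) := by simp
      _ = _ := by rw [hl, hr]; simp
  have e2 : (0 : ℤ) :: (l ++ [x]) = l' ++ [z, x] := by
    calc _ = ((0 : ℤ) :: l) ++ [x] := by simp
      _ = _ := by rw [hl]; simp
  rw [← hwl, ← hwr, wordWeight, e1, e2, hr, innerWeight_append]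
  simp only [innerWeight, letterWeight, hz, hc]
  ring

end Words

/-!
### Sums of weights over classes of words
-/

section Runs

variable {A : Type*} [CommRing A] {P : Type*}

/-- The sum of the weights of all words with `n` distinct letters of sign `s`. -/
def runWeight (p q u v : A) (s : ℤ) : ℕ → A
  | 0 => 1
  | n + 1 => ∑ k : Fin (n + 1), (n.choose k : A) *
      (letterWeight p q u v (if (k : ℕ) = 0 then 0 else 2 * s) s
        (if n - k = 0 then 0 else 2 * s) * (runWeight p q u v s k * runWeight p q u v s (n - k)))
  decreasing_by all_goals omega

theorem runWeight_succ (p q u v : A) (s : ℤ) (n : ℕ) :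
    runWeight p q u v s (n + 1) = ∑ k ∈ Finset.range (n + 1), (n.choose k : A) *
      (letterWeight p q u v (if k = 0 then 0 else 2 * s) s (if n - k = 0 then 0 else 2 * s) *
        (runWeight p q u v s k * runWeight p q u v s (n - k))) := by
  rw [runWeight, Finset.sum_range]

/-- For at least two letters, `u` and `v` are the weights of the pivot in the terms `k = 0` and `k =
n`, in an order depending on `s`. The other factors of these two terms agree, so only `u + v`
enters; in all other terms the pivot has weight `p` or `q`. -/
theorem runWeight_congr (p q u v u' v' : A) (h : u + v = u' + v') (s : ℤ) (hs : s = 1 ∨ s = -1)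
    (n : ℕ) : runWeight p q u v s n = runWeight p q u' v' s n := by
  induction n using Nat.strong_induction_on with
  | _ n ih =>
  rcases n with _ | _ | n
  · simp [runWeight]
  · rcases hs with rfl | rfl <;> simp [runWeight, letterWeight]
  · have hsum : ∀ F : ℕ → A, ∑ k ∈ Finset.range (n + 1 + 1), F k =
        ∑ k ∈ Finset.range n, F (k + 1) + (F 0 + F (n + 1)) := fun F => by
      rw [Finset.sum_range_succ, Finset.sum_range_succ', add_assoc]
    rw [runWeight_succ, runWeight_succ, hsum, hsum]
    congr 1
    · refine Finset.sum_congr rfl fun k hk => ?_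
      have hk := Finset.mem_range.1 hk
      rw [ih (k + 1) (by omega), ih (n + 1 - (k + 1)) (by omega)]
      have : n - k ≠ 0 := by omega
      rcases hs with rfl | rfl <;> simp [letterWeight, this]
    · have h0 : runWeight p q u v s 0 = 1 := by simp [runWeight]
      have h0' : runWeight p q u' v' s 0 = 1 := by simp [runWeight]
      rcases hs with rfl | rfl <;> simp [letterWeight, h0, h0', ih (n + 1) (by omega)]
      · linear_combination runWeight p q u' v' 1 (n + 1) * h
      · linear_combination runWeight p q u' v' (-1) (n + 1) * h

variable [DecidableEq P]

/-- The words in which every element of `R` occurs exactly once. -/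
def arrangements (R : Finset P) : Finset (List P) := R.val.lists.toFinset

theorem mem_arrangements {R : Finset P} {l : List P} :
    l ∈ arrangements R ↔ l.Nodup ∧ ∀ x, x ∈ l ↔ x ∈ R := by
  rw [arrangements, Multiset.mem_toFinset, Multiset.mem_lists_iff]
  constructor
  · intro h
    have h' : R.val = (l : Multiset P) := h
    refine ⟨?_, fun x => ?_⟩
    · have := R.nodup
      rwa [h', Multiset.coe_nodup] at this
    · rw [← Finset.mem_val, h', Multiset.mem_coe]
  · rintro ⟨h₁, h₂⟩
    show R.val = (l : Multiset P)
    rw [Multiset.Nodup.ext R.nodup (Multiset.coe_nodup.2 h₁)]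
    simp [h₂]

theorem length_of_mem_arrangements {R : Finset P} {l : List P} (h : l ∈ arrangements R) :
    l.length = R.card := by
  rw [mem_arrangements] at h
  rw [← List.toFinset_card_of_nodup h.1]
  congr 1
  ext x
  simp [h.2]

theorem perm_of_mem_arrangements {R : Finset P} {l l' : List P} (h : l ∈ arrangements R)
    (h' : l' ∈ arrangements R) : l.Perm l' := by
  rw [mem_arrangements] at h h'
  exact (List.perm_ext_iff_of_nodup h.1 h'.1).2 fun x => by rw [h.2, h'.2]

theorem sum_arrangements (R : Finset P) (x : P) (hx : x ∈ R) (f : List P → A) :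
    ∑ l ∈ arrangements R, f l = ∑ B ∈ (R.erase x).powerset, ∑ l ∈ arrangements B,
      ∑ l' ∈ arrangements (R.erase x \ B), f (l ++ x :: l') := by
  simp_rw [← Finset.sum_product', Finset.sum_sigma']
  symm
  refine Finset.sum_bij (fun z _ => z.2.1 ++ x :: z.2.2) ?_ ?_ ?_ (fun _ _ => rfl)
  · rintro ⟨B, l, l'⟩ h
    simp only [Finset.mem_sigma, Finset.mem_powerset, Finset.mem_product, mem_arrangements,
      Finset.mem_sdiff, Finset.mem_erase] at h ⊢
    obtain ⟨hB, ⟨h₁, h₂⟩, h₃, h₄⟩ := h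
    have hB' : ∀ y ∈ B, y ≠ x ∧ y ∈ R := fun y hy => by simpa using hB hy
    refine ⟨?_, fun y => ?_⟩
    · rw [List.nodup_append, List.nodup_cons]
      refine ⟨h₁, ⟨by simp [h₄], h₃⟩, ?_⟩
      intro a ha b hb hab
      subst hab
      rw [h₂] at ha
      rcases List.mem_cons.1 hb with rfl | hb
      · exact (hB' _ ha).1 rfl
      · exact ((h₄ _).1 hb).2 ha
    · simp only [List.mem_append, List.mem_cons, h₂, h₄]
      have := hB' y
      by_cases hy : y = x
      · simp [hy, hx]
      · tauto
  · rintro ⟨B, l, l'⟩ h ⟨B', m, m'⟩ h' e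
    simp only [Finset.mem_sigma, Finset.mem_powerset, Finset.mem_product, mem_arrangements,
      Finset.mem_sdiff, Finset.mem_erase] at h h' e
    have hxl : x ∉ l := fun hm => by simpa using h.1 ((h.2.1.2 x).1 hm)
    have hxm : x ∉ m := fun hm => by simpa using h'.1 ((h'.2.1.2 x).1 hm)
    obtain ⟨rfl, rfl⟩ : l = m ∧ l' = m' := by
      -- The index of `x` is the length of the left part, so the cut can be recovered.
      have hlen := congrArg (List.idxOf x) e
      simp only [List.idxOf_append, hxl, hxm, if_false, List.idxOf_cons_self,
        Nat.zero_add] at hlen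
      simpa using List.append_inj e hlen
    obtain rfl : B = B' := by
      ext y
      rw [← h.2.1.2, h'.2.1.2]
    rfl
  · intro l h
    rw [mem_arrangements] at h
    obtain ⟨l₁, l₂, rfl⟩ := List.append_of_mem ((h.2 x).2 hx)
    obtain ⟨h₁, h₂⟩ := h
    rw [List.nodup_append, List.nodup_cons] at h₁
    refine ⟨⟨l₁.toFinset, l₁, l₂⟩, ?_, rfl⟩
    simp only [Finset.mem_sigma, Finset.mem_powerset, Finset.mem_product, mem_arrangements,
      Finset.mem_sdiff, Finset.mem_erase]
    refine ⟨fun y hy => ?_, ⟨h₁.1, by simp⟩, h₁.2.1.2, fun y => ?_⟩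
    · rw [List.mem_toFinset] at hy
      rw [Finset.mem_erase, ← h₂]
      exact ⟨h₁.2.2 y hy x (by simp), by simp [hy]⟩
    · rw [← h₂]
      simp only [List.mem_toFinset, List.mem_append, List.mem_cons]
      constructor
      · intro hy
        exact ⟨⟨fun e => h₁.2.1.1 (e ▸ hy), by simp [hy]⟩, fun hy' => h₁.2.2 y hy' y (by simp [hy]) rfl⟩
      · tauto

/-- The sign of the labels of a run. -/
def runSign (b : Bool) : ℤ := if b then 1 else -1

/-- The labeling `ω` is nowhere zero, and `ω x` is positive if and only if `sg x` is true. -/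
def HasSign (ω : P → ℤ) (sg : P → Bool) : Prop :=
  ∀ x, sg x = true ∧ 0 < ω x ∨ sg x = false ∧ ω x < 0

/-- Cutting at the letter of least absolute value reproduces the recursion of `runWeight`: a term
depends on the set `B` of letters before the cut only through its size, whence the binomial
coefficients. -/
theorem sum_arrangements_wordWeight (p q u v : A) (ω : P → ℤ) (hω : Function.Injective ω)
    (sg : P → Bool) (hsg : HasSign ω sg) (b : Bool) (R : Finset P) (hR : ∀ x ∈ R, sg x = b) :
    ∑ l ∈ arrangements R, wordWeight p q u v (l.map ω) =
      runWeight p q u v (runSign b) R.card := by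
  induction hn : R.card using Nat.strong_induction_on generalizing R with
  | _ n ih =>
  subst hn
  rcases R.eq_empty_or_nonempty with rfl | hne
  · have : arrangements (∅ : Finset P) = {[]} := by
      ext l
      rw [mem_arrangements]
      simp only [Finset.notMem_empty, iff_false, Finset.mem_singleton]
      constructor
      · exact fun h => List.eq_nil_iff_forall_not_mem.2 h.2
      · rintro rfl; simp
    rw [this]
    simp [wordWeight, innerWeight, runWeight]
  obtain ⟨x, hx, hmin⟩ := R.exists_min_image (fun x => |ω x|) hne
  have hxs : ∀ y ∈ R.erase x, runSign b = 1 ∧ 0 < ω x ∧ ω x < ω y ∨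
      runSign b = -1 ∧ ω x < 0 ∧ ω y < ω x := by
    intro y hy
    obtain ⟨hyx, hy⟩ := Finset.mem_erase.1 hy
    have h₁ := hmin y hy
    have h₂ : ω y ≠ ω x := fun e => hyx (hω e)
    have h₃ := hR x hx
    have h₄ := hR y hy
    rcases hsg x with ⟨h₅, h₆⟩ | ⟨h₅, h₆⟩ <;> rcases hsg y with ⟨h₇, h₈⟩ | ⟨h₇, h₈⟩
    · left
      rw [abs_of_pos h₆, abs_of_pos h₈] at h₁
      refine ⟨by simp [runSign, ← h₃, h₅], h₆, by omega⟩
    · simp_all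
    · simp_all
    · right
      rw [abs_of_neg h₆, abs_of_neg h₈] at h₁
      refine ⟨by simp [runSign, ← h₃, h₅], h₆, by omega⟩
  have hxb : runSign b = 1 ∧ 0 < ω x ∨ runSign b = -1 ∧ ω x < 0 := by
    have h₃ := hR x hx
    rcases hsg x with ⟨h₅, h₆⟩ | ⟨h₅, h₆⟩
    · left; exact ⟨by simp [runSign, ← h₃, h₅], h₆⟩
    · right; exact ⟨by simp [runSign, ← h₃, h₅], h₆⟩
  obtain ⟨n, hn⟩ : ∃ n, R.card = n + 1 := ⟨R.card - 1, by have := hne.card_pos; omega⟩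
  have hcard : (R.erase x).card = n := by rw [Finset.card_erase_of_mem hx]; omega
  rw [sum_arrangements R x hx, hn, runWeight_succ]
  have hstep : ∀ B ∈ (R.erase x).powerset, ∑ l ∈ arrangements B,
      ∑ l' ∈ arrangements (R.erase x \ B), wordWeight p q u v ((l ++ x :: l').map ω) =
      letterWeight p q u v (if B.card = 0 then 0 else 2 * runSign b) (runSign b)
        (if n - B.card = 0 then 0 else 2 * runSign b) *
        (runWeight p q u v (runSign b) B.card * runWeight p q u v (runSign b) (n - B.card)) := by
    intro B hB
    have hB := Finset.mem_powerset.1 hB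
    have hBle := Finset.card_le_card hB
    have hc : (R.erase x \ B).card = n - B.card := by
      rw [Finset.card_sdiff_of_subset hB, hcard]
    rw [← hc, ← ih B.card (by omega) B (fun y hy => hR y (Finset.mem_of_mem_erase (hB hy))) rfl,
      ← ih _ (by omega) (R.erase x \ B)
        (fun y hy => hR y (Finset.mem_of_mem_erase (Finset.mem_sdiff.1 hy).1)) rfl,
      Finset.sum_mul_sum, Finset.mul_sum]
    refine Finset.sum_congr rfl fun l hl => ?_
    rw [Finset.mul_sum]
    refine Finset.sum_congr rfl fun l' hl' => ?_
    rw [← length_of_mem_arrangements hl, ← length_of_mem_arrangements hl', List.map_append,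
      List.map_cons, wordWeight_append_cons p q u v (runSign b) (l.map ω) (l'.map ω) (ω x)]
    · simp
    · have hmem : ∀ y ∈ l.map ω ++ l'.map ω, ∃ z ∈ R.erase x, ω z = y := by
        intro y hy
        rw [← List.map_append, List.mem_map] at hy
        obtain ⟨z, hz, rfl⟩ := hy
        refine ⟨z, ?_, rfl⟩
        rcases List.mem_append.1 hz with hz | hz
        · exact hB (((mem_arrangements.1 hl).2 z).1 hz)
        · exact (Finset.mem_sdiff.1 (((mem_arrangements.1 hl').2 z).1 hz)).1
      rcases hxb with ⟨h₁, h₂⟩ | ⟨h₁, h₂⟩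
      · refine .inl ⟨h₁, h₂, fun y hy => ?_⟩
        obtain ⟨z, hz, rfl⟩ := hmem y hy
        have := hxs z hz
        omega
      · refine .inr ⟨h₁, h₂, fun y hy => ?_⟩
        obtain ⟨z, hz, rfl⟩ := hmem y hy
        have := hxs z hz
        omega
  rw [Finset.sum_congr rfl hstep, Finset.sum_powerset_apply_card (fun k =>
      letterWeight p q u v (if k = 0 then 0 else 2 * runSign b) (runSign b)
        (if n - k = 0 then 0 else 2 * runSign b) *
        (runWeight p q u v (runSign b) k * runWeight p q u v (runSign b) (n - k))), hcard]
  simp only [nsmul_eq_mul]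

end Runs

/-! ### Decomposition of words into maximal runs of equal sign. -/

section Classes

variable {A : Type*} [CommRing A] {P : Type*} [DecidableEq P]

/-- The sequence of maximal runs of letters of equal sign in a word; a run is recorded as its sign
and its set of letters. -/
def runKey (sg : P → Bool) : List P → List (Bool × Finset P)
  | [] => []
  | x :: l => match runKey sg l with
    | [] => [(sg x, {x})]
    | (b, R) :: K => if sg x = b then (b, insert x R) :: K else (sg x, {x}) :: (b, R) :: K

/-- The words that are obtained by arranging the elements of each run. -/
def runClass : List (Bool × Finset P) → Finset (List P)
  | [] => {[]}
  | z :: K => (arrangements z.2 ×ˢ runClass K).image fun y => y.1 ++ y.2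

/-- The sequences of runs that belong to words. -/
def IsRunKey (sg : P → Bool) (K : List (Bool × Finset P)) : Prop :=
  (∀ z ∈ K, z.2.Nonempty ∧ ∀ y ∈ z.2, sg y = z.1) ∧ K.IsChain fun z w => z.1 ≠ w.1

theorem IsRunKey.tail {sg : P → Bool} {z : Bool × Finset P} {K : List (Bool × Finset P)}
    (h : IsRunKey sg (z :: K)) : IsRunKey sg K :=
  ⟨fun w hw => h.1 w (List.mem_cons_of_mem _ hw), (List.isChain_cons.1 h.2).2⟩

theorem isRunKey_runKey (sg : P → Bool) (l : List P) : IsRunKey sg (runKey sg l) := by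
  induction l with
  | nil => simp [runKey, IsRunKey]
  | cons x l ih =>
    rw [runKey]
    rcases hK : runKey sg l with _ | ⟨⟨b, R⟩, K⟩
    · simp [IsRunKey]
    · rw [hK] at ih
      obtain ⟨h₁, h₂⟩ := ih
      by_cases hx : sg x = b
      · simp only [hx, if_true]
        refine ⟨?_, ?_⟩
        · intro z hz
          rcases List.mem_cons.1 hz with rfl | hz
          · refine ⟨by simp, fun y hy => ?_⟩
            rcases Finset.mem_insert.1 hy with rfl | hy
            · exact hx
            · exact (h₁ (b, R) (by simp)).2 y hy
          · exact h₁ z (List.mem_cons_of_mem _ hz)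
        · rw [List.isChain_cons] at h₂ ⊢
          exact h₂
      · simp only [hx, if_false]
        refine ⟨?_, ?_⟩
        · intro z hz
          rcases List.mem_cons.1 hz with rfl | hz
          · simp
          · exact h₁ z hz
        · rw [List.isChain_cons]
          exact ⟨by simpa using hx, h₂⟩

theorem mem_runClass_runKey (sg : P → Bool) (l : List P) (hl : l.Nodup) :
    l ∈ runClass (runKey sg l) := by
  induction l with
  | nil => simp [runKey, runClass]
  | cons x l ih =>
    have ih := ih hl.of_cons
    have hxl := (List.nodup_cons.1 hl).1
    rw [runKey]
    rcases hK : runKey sg l with _ | ⟨⟨b, R⟩, K⟩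
    · rw [hK] at ih
      obtain rfl : l = [] := by simpa [runClass] using ih
      simp only [runClass, Finset.mem_image, Finset.mem_product, Finset.mem_singleton]
      exact ⟨([x], []), ⟨by simp [mem_arrangements], rfl⟩, rfl⟩
    · rw [hK] at ih
      by_cases hx : sg x = b
      · simp only [hx, if_true]
        simp only [runClass, Finset.mem_image, Finset.mem_product] at ih ⊢
        obtain ⟨⟨s, t⟩, ⟨h₁, h₂⟩, rfl⟩ := ih
        refine ⟨(x :: s, t), ⟨?_, h₂⟩, rfl⟩
        rw [mem_arrangements] at h₁ ⊢
        simp only at h₁ hxl ⊢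
        refine ⟨List.nodup_cons.2 ⟨fun h => hxl (List.mem_append_left _ h), h₁.1⟩, fun y => ?_⟩
        simp [h₁.2]
      · simp only [hx, if_false]
        rw [runClass, Finset.mem_image]
        exact ⟨([x], l), Finset.mem_product.2 ⟨by simp [mem_arrangements], ih⟩, rfl⟩

theorem runKey_append (sg : P → Bool) (b : Bool) (s t : List P) (hs : s ≠ [])
    (hb : ∀ y ∈ s, sg y = b) (ht : ∀ z ∈ (runKey sg t).head?, b ≠ z.1) :
    runKey sg (s ++ t) = (b, s.toFinset) :: runKey sg t := by
  induction s with
  | nil => exact absurd rfl hs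
  | cons x s ih =>
    have hx := hb x (by simp)
    rw [List.cons_append, runKey]
    by_cases h : s = []
    · subst h
      rw [List.nil_append]
      rcases hK : runKey sg t with _ | ⟨⟨b', R⟩, K⟩
      · simp [hx]
      · have : b ≠ b' := by simpa [hK] using ht
        simp [hx, this]
    · rw [ih h fun y hy => hb y (List.mem_cons_of_mem _ hy)]
      simp [hx]

/-- Consecutive runs have different signs and cannot merge. Together with `mem_runClass_runKey`, the
classes partition the words without repetition. -/
theorem runKey_of_mem_runClass (sg : P → Bool) (K : List (Bool × Finset P)) (hK : IsRunKey sg K)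
    (l : List P) (hl : l ∈ runClass K) : runKey sg l = K := by
  induction K generalizing l with
  | nil =>
    obtain rfl : l = [] := by simpa [runClass] using hl
    rfl
  | cons z K ih =>
    obtain ⟨b, R⟩ := z
    simp only [runClass, Finset.mem_image, Finset.mem_product] at hl
    obtain ⟨⟨s, t⟩, ⟨h₁, h₂⟩, rfl⟩ := hl
    simp only at h₁ h₂ ⊢
    have ht := ih hK.tail t h₂
    obtain ⟨⟨x, hx⟩, hR⟩ := hK.1 (b, R) (by simp)
    rw [mem_arrangements] at h₁
    rw [runKey_append sg b s t, ht]
    · congr 2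
      ext y
      simp [h₁.2]
    · rintro rfl
      simpa using (h₁.2 x).2 hx
    · exact fun y hy => hR y ((h₁.2 y).1 hy)
    · rw [ht]
      exact (List.isChain_cons.1 hK.2).1

theorem sum_runClass (p q u v : A) (ω : P → ℤ) (hω : Function.Injective ω)
    (sg : P → Bool) (hsg : HasSign ω sg) (K : List (Bool × Finset P)) (hK : IsRunKey sg K) :
    ∑ l ∈ runClass K, wordWeight p q u v (l.map ω) =
      (K.map fun z => runWeight p q u v (runSign z.1) z.2.card).prod := by
  induction K with
  | nil => simp [runClass, wordWeight, innerWeight]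
  | cons z K ih =>
    obtain ⟨b, R⟩ := z
    obtain ⟨hne, hR⟩ := hK.1 (b, R) (by simp)
    simp only at hne hR
    rw [runClass, Finset.sum_image, List.map_cons, List.prod_cons, ← ih hK.tail,
      ← sum_arrangements_wordWeight p q u v ω hω sg hsg b R hR, Finset.sum_mul_sum,
      Finset.sum_product]
    · refine Finset.sum_congr rfl fun s hs => Finset.sum_congr rfl fun t ht => ?_
      simp only at hs ⊢
      rw [mem_arrangements] at hs
      rcases K with _ | ⟨⟨b', R'⟩, K⟩
      · obtain rfl : t = [] := by simpa [runClass] using ht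
        simp [wordWeight, innerWeight]
      obtain ⟨hne', hR'⟩ := hK.1 (b', R') (by simp)
      simp only at hne' hR'
      have hbb : b ≠ b' := by
        have := (List.isChain_cons.1 hK.2).1
        simpa using this
      simp only [runClass, Finset.mem_image, Finset.mem_product] at ht
      obtain ⟨⟨s', t'⟩, ⟨hs', -⟩, rfl⟩ := ht
      rw [mem_arrangements] at hs'
      simp only at hs' ⊢
      rcases List.eq_nil_or_concat s with rfl | ⟨s, x, rfl⟩
      · obtain ⟨x, hx⟩ := hne
        simpa using (hs.2 x).2 hx
      rcases s' with _ | ⟨y, s'⟩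
      · obtain ⟨x, hx⟩ := hne'
        simpa using (hs'.2 x).2 hx
      have hx := hR x ((hs.2 x).1 (by simp))
      have hy := hR' y ((hs'.2 y).1 (by simp))
      have hxy : ω x < 0 ∧ 0 < ω y ∨ ω y < 0 ∧ 0 < ω x := by
        rcases hsg x with ⟨h₁, h₂⟩ | ⟨h₁, h₂⟩ <;> rcases hsg y with ⟨h₃, h₄⟩ | ⟨h₃, h₄⟩
        · exact absurd (by rw [← hx, ← hy, h₁, h₃]) hbb
        · exact .inr ⟨h₄, h₂⟩
        · exact .inl ⟨h₂, h₄⟩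
        · exact absurd (by rw [← hx, ← hy, h₁, h₃]) hbb
      have := wordWeight_append p q u v (s.map ω) ((s' ++ t').map ω) (ω x) (ω y) hxy
      simpa using this
    · rintro ⟨s, t⟩ h ⟨s', t'⟩ h' e
      simp only [Finset.coe_product, Set.mem_prod, Finset.mem_coe] at h h' e
      have := List.append_inj e
        (by rw [length_of_mem_arrangements h.1, length_of_mem_arrangements h'.1])
      rw [this.1, this.2]

/-- A set of words is closed under exchanging neighbouring letters of equal sign. -/
def SwapClosed (sg : P → Bool) (L : Finset (List P)) : Prop :=
  ∀ (s t : List P) (x y : P), sg x = sg y → s ++ x :: y :: t ∈ L → s ++ y :: x :: t ∈ L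

/-- Adjacent transpositions generate all rearrangements of a run. The context `s`, `t` is general
because the induction on `List.Perm` moves letters into it. -/
theorem SwapClosed.perm {sg : P → Bool} {L : Finset (List P)} (hL : SwapClosed sg L) (b : Bool)
    {m m' : List P} (h : m.Perm m') : ∀ (_ : ∀ x ∈ m, sg x = b) (s t : List P),
    s ++ m ++ t ∈ L → s ++ m' ++ t ∈ L := by
  induction h with
  | nil => exact fun _ _ _ h => h
  | cons x _ ih =>
    intro hb s t h
    have := ih (fun y hy => hb y (List.mem_cons_of_mem _ hy)) (s ++ [x]) t
    simp only [List.append_assoc, List.cons_append, List.nil_append] at this h ⊢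
    exact this h
  | swap x y l =>
    intro hb s t h
    have := hL s (l ++ t) y x (by rw [hb y (by simp), hb x (by simp)])
    simp only [List.append_assoc, List.cons_append] at h ⊢
    exact this h
  | trans h₁ _ ih₁ ih₂ =>
    intro hb s t h
    exact ih₂ (fun x hx => hb x (h₁.mem_iff.2 hx)) s t (ih₁ hb s t h)

/-- Runs are rearranged from left to right; `s` collects those already done. -/
theorem SwapClosed.mem_of_mem_runClass {sg : P → Bool} {L : Finset (List P)}
    (hL : SwapClosed sg L) (K : List (Bool × Finset P)) (hK : IsRunKey sg K) (l l' : List P)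
    (hl : l ∈ runClass K) (hl' : l' ∈ runClass K) (s : List P) (h : s ++ l ∈ L) :
    s ++ l' ∈ L := by
  induction K generalizing l l' s with
  | nil =>
    obtain rfl : l = [] := by simpa [runClass] using hl
    obtain rfl : l' = [] := by simpa [runClass] using hl'
    exact h
  | cons z K ih =>
    simp only [runClass, Finset.mem_image, Finset.mem_product] at hl hl'
    obtain ⟨⟨m, t⟩, ⟨h₁, h₂⟩, rfl⟩ := hl
    obtain ⟨⟨m', t'⟩, ⟨h₁', h₂'⟩, rfl⟩ := hl'
    simp only at h₁ h₂ h₁' h₂' h ⊢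
    have h₃ := hL.perm z.1 (perm_of_mem_arrangements h₁ h₁')
      (fun x hx => (hK.1 z (by simp)).2 x (((mem_arrangements.1 h₁).2 x).1 hx)) s t
      (by simpa using h)
    simpa using ih hK.tail t t' h₂ h₂' (s ++ m') h₃

/-- The total weight of a set of words that is closed under exchanging neighbouring letters of
equal sign, in terms of the signs of the labels. -/
theorem SwapClosed.sum_wordWeight {sg : P → Bool} {L : Finset (List P)}
    (hL : SwapClosed sg L) (hnd : ∀ l ∈ L, l.Nodup) (p q u v : A) (ω : P → ℤ)
    (hω : Function.Injective ω) (hsg : HasSign ω sg) :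
    ∑ l ∈ L, wordWeight p q u v (l.map ω) = ∑ K ∈ L.image (runKey sg),
      (K.map fun z => runWeight p q u v (runSign z.1) z.2.card).prod := by
  rw [← Finset.sum_fiberwise_of_maps_to (g := runKey sg) (t := L.image (runKey sg))
    fun l hl => Finset.mem_image_of_mem _ hl]
  refine Finset.sum_congr rfl fun K hK => ?_
  obtain ⟨l, hl, rfl⟩ := Finset.mem_image.1 hK
  have hkey := isRunKey_runKey sg l
  rw [← sum_runClass p q u v ω hω sg hsg _ hkey]
  refine Finset.sum_congr ?_ fun _ _ => rfl
  ext l'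
  rw [Finset.mem_filter]
  constructor
  · rintro ⟨h₁, h₂⟩
    rw [← h₂]
    exact mem_runClass_runKey sg l' (hnd l' h₁)
  · intro h
    exact ⟨hL.mem_of_mem_runClass _ hkey l l' (mem_runClass_runKey sg l (hnd l hl)) h [] hl,
      runKey_of_mem_runClass sg _ hkey l' h⟩

/-- The formula in `SwapClosed.sum_wordWeight` sees a labeling only through `sg`, and by
`runWeight_congr` sees `u`, `v` only through their sum. -/
theorem SwapClosed.sum_wordWeight_congr {sg : P → Bool} {L : Finset (List P)}
    (hL : SwapClosed sg L) (hnd : ∀ l ∈ L, l.Nodup) (p q u v u' v' : A) (h : u + v = u' + v')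
    (ω ω' : P → ℤ) (hω : Function.Injective ω) (hω' : Function.Injective ω')
    (hsg : HasSign ω sg) (hsg' : HasSign ω' sg) :
    ∑ l ∈ L, wordWeight p q u v (l.map ω) = ∑ l ∈ L, wordWeight p q u' v' (l.map ω') := by
  rw [hL.sum_wordWeight hnd p q u v ω hω hsg, hL.sum_wordWeight hnd p q u' v' ω' hω' hsg']
  refine Finset.sum_congr rfl fun K _ => ?_
  congr 1
  refine List.map_congr_left fun z _ => runWeight_congr p q u v u' v' h _ ?_ _
  rw [runSign]
  split_ifs <;> simp

end Classes

/-!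
### Canonical labelings
-/

section Canonical

theorem signSum_append_pair {P : Type*} (ω : P → ℤ) (a b : P) : ∀ l : List P,
    signSum ω (l ++ [a, b]) = signSum ω (l ++ [a]) + edgeSign ω a b
  | [] => by simp [signSum]
  | [x] => by simp [signSum]
  | x :: y :: l => by
      have := signSum_append_pair ω a b (y :: l)
      simp only [List.cons_append, signSum] at this ⊢
      rw [this, add_assoc]

variable {P : Type*} [PartialOrder P]

/-- The signs of the labels alternate along saturated chains, beginning with negative labels at the
minimal elements. -/
structure IsAlternating (ω : P → ℤ) : Prop where
  injective : Function.Injective ω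
  ne_zero : ∀ x, ω x ≠ 0
  neg_of_isMin : ∀ x, IsMin x → ω x < 0
  covBy : ∀ x y, x ⋖ y → (ω x < 0 ↔ 0 < ω y)

theorem IsSaturatedChainTo.append_covBy {l : List P} {x y : P} (h : IsSaturatedChainTo l x)
    (hxy : x ⋖ y) : IsSaturatedChainTo (l ++ [y]) y := by
  obtain ⟨h₁, ⟨m, hm, h₂⟩, h₃⟩ := h
  refine ⟨?_, ⟨m, hm, ?_⟩, by simp⟩
  · rw [List.isChain_append]
    refine ⟨h₁, by simp, ?_⟩
    intro a ha b hb
    rw [h₃] at ha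
    simp only [Option.mem_def, Option.some.injEq, List.head?_cons] at ha hb
    subst ha hb
    exact hxy
  · rw [List.head?_append, h₂]
    rfl

theorem signSum_append_covBy {ω : P → ℤ} {l : List P} {x : P} (h : IsSaturatedChainTo l x) (y : P) :
    signSum ω (l ++ [y]) = signSum ω l + edgeSign ω x y := by
  obtain ⟨l, rfl⟩ := List.getLast?_eq_some_iff.1 h.2.2
  simpa using signSum_append_pair ω x y l

theorem isSaturatedChainTo_singleton {x : P} (hx : IsMin x) : IsSaturatedChainTo [x] x :=
  ⟨by simp, ⟨x, hx, rfl⟩, rfl⟩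

theorem exists_isSaturatedChainTo [Finite P] (x : P) : ∃ l, IsSaturatedChainTo l x := by
  induction x using WellFoundedLT.induction with
  | _ x ih =>
  by_cases hx : IsMin x
  · exact ⟨[x], isSaturatedChainTo_singleton hx⟩
  · obtain ⟨y, hy⟩ := not_isMin_iff.1 hx
    obtain ⟨z, -, hz⟩ := exists_le_covBy_of_lt hy
    obtain ⟨l, hl⟩ := ih z hz.lt
    exact ⟨_, hl.append_covBy hz⟩

/-- The rank changes by one along a cover, so with values in {0, 1} it must flip, and the sign of
the label with it. -/
theorem IsCanonicalLabeling.isAlternating [Finite P] {ω : P → ℤ} (h : IsCanonicalLabeling ω) :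
    IsAlternating ω := by
  obtain ⟨ρ, h₁, h₂, h₃, h₄⟩ := h.rank
  refine ⟨h.injective, fun x => ?_, fun x hx => ?_, fun x y hxy => ?_⟩
  · rcases h₂ x with hx | hx
    · exact (h₃ x hx).ne
    · exact (h₄ x hx).ne'
  · exact h₃ x (h₁ _ _ (isSaturatedChainTo_singleton hx)).symm
  · obtain ⟨l, hl⟩ := exists_isSaturatedChainTo x
    have e₁ := h₁ _ _ hl
    have e₂ := h₁ _ _ (hl.append_covBy hxy)
    rw [signSum_append_covBy hl y, e₁, edgeSign] at e₂
    rcases h₂ x with hx | hx <;> rcases h₂ y with hy | hy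
    · split_ifs at e₂ <;> omega
    · exact iff_of_true (h₃ x hx) (h₄ y hy)
    · exact iff_of_false (h₄ x hx).not_gt (h₃ y hy).not_gt
    · split_ifs at e₂ <;> omega

/-- Each edge sign is the difference of the positivity indicators of its ends, so the sum
telescopes. -/
theorem IsAlternating.signSum_cons {ω : P → ℤ} (h : IsAlternating ω) (x : P) :
    ∀ (l : List P) (y : P), (y :: l).IsChain (· ⋖ ·) → (y :: l).getLast? = some x →
      signSum ω (y :: l) = (if 0 < ω x then 1 else 0) - (if 0 < ω y then 1 else 0) := by
  intro l
  induction l with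
  | nil =>
    intro y _ hx
    obtain rfl : y = x := by simpa using hx
    simp [signSum]
  | cons z l ih =>
    intro y hc hx
    obtain ⟨hyz, hc⟩ := List.isChain_cons_cons.1 hc
    rw [signSum, ih z hc (by simpa using hx), edgeSign]
    have := h.covBy y z hyz
    have := h.ne_zero y
    have := h.ne_zero z
    split_ifs <;> omega

theorem IsAlternating.signSum_eq {ω : P → ℤ} (h : IsAlternating ω) {l : List P} {x : P}
    (hl : IsSaturatedChainTo l x) : signSum ω l = if 0 < ω x then 1 else 0 := by
  obtain ⟨h₁, ⟨m, hm, h₂⟩, h₃⟩ := hl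
  obtain ⟨l, rfl⟩ := List.head?_eq_some_iff.1 h₂
  rw [h.signSum_cons x l m h₁ h₃, if_neg (c := 0 < ω m) (h.neg_of_isMin m hm).not_gt, sub_zero]

theorem IsAlternating.isCanonicalLabeling {ω : P → ℤ} (h : IsAlternating ω)
    (hmax : ∀ x, IsMax x → ω x < 0) : IsCanonicalLabeling ω := by
  refine ⟨h.injective, ⟨0, ?_⟩, fun x => if 0 < ω x then 1 else 0, fun l x hl => h.signSum_eq hl,
    fun x => ?_, fun x hx => ?_, fun x hx => ?_⟩
  · rintro l ⟨x, hx, hl⟩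
    rw [h.signSum_eq hl, if_neg (hmax x hx).not_gt]
  · by_cases h₀ : 0 < ω x <;> simp [h₀]
  · have := h.ne_zero x
    by_cases h₀ : 0 < ω x
    · simp [h₀] at hx
    · omega
  · by_contra h₀
    simp [h₀] at hx

/-- The rank of a sign-graded poset with alternating labels tells the sign of the labels of the
maximal elements. -/
theorem IsAlternating.rank_eq [Finite P] {ω : P → ℤ} (h : IsAlternating ω) {r : ℤ}
    (hr : IsSignGradedOfRank ω r) (x : P) (hx : IsMax x) : r = if 0 < ω x then 1 else 0 := by
  obtain ⟨l, hl⟩ := exists_isSaturatedChainTo x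
  rw [← hr l ⟨x, hx, hl⟩, h.signSum_eq hl]

/-- Negativity at minimal elements propagates upwards along covers, so the order alone determines
the signs. -/
theorem IsAlternating.pos_iff [Finite P] {ω ω' : P → ℤ} (h : IsAlternating ω)
    (h' : IsAlternating ω') (x : P) : 0 < ω x ↔ 0 < ω' x := by
  induction x using WellFoundedLT.induction with
  | _ x ih =>
  by_cases hx : IsMin x
  · have := h.neg_of_isMin x hx
    have := h'.neg_of_isMin x hx
    omega
  · obtain ⟨y, hy⟩ := not_isMin_iff.1 hx
    obtain ⟨z, -, hz⟩ := exists_le_covBy_of_lt hy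
    have := ih z hz.lt
    have := h.covBy z x hz
    have := h'.covBy z x hz
    have := h.ne_zero z
    have := h'.ne_zero z
    omega

theorem IsAlternating.hasSign {ω ω' : P → ℤ} (h : IsAlternating ω')
    (hs : ∀ x, 0 < ω x ↔ 0 < ω' x) : HasSign ω' fun x => decide (0 < ω x) := by
  intro x
  have := h.ne_zero x
  have := hs x
  simp only [decide_eq_true_eq, decide_eq_false_iff_not]
  omega

theorem IsAlternating.comp_coe {ω : WithTop P → ℤ} (h : IsAlternating ω) :
    IsAlternating fun x : P => ω x := by
  refine ⟨fun x y e => WithTop.coe_injective (h.injective e), fun x => h.ne_zero _,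
    fun x hx => h.neg_of_isMin _ ?_, fun x y hxy => h.covBy _ _ ?_⟩
  · intro y hy
    induction y with
    | top => exact le_top
    | coe y => exact WithTop.coe_le_coe.2 (hx (WithTop.coe_le_coe.1 hy))
  · refine ⟨WithTop.coe_lt_coe.2 hxy.1, fun z hz hz' => ?_⟩
    induction z with
    | top => exact not_top_lt hz'
    | coe z => exact hxy.2 (WithTop.coe_lt_coe.1 hz) (WithTop.coe_lt_coe.1 hz')

theorem isMax_of_covBy_top {x : P} (h : (x : WithTop P) ⋖ ⊤) : IsMax x := by
  rw [isMax_iff_forall_not_lt]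
  exact fun y hy => h.2 (WithTop.coe_lt_coe.2 hy) (WithTop.coe_lt_top y)

theorem IsAlternating.exists_withTop [Finite P] [Nonempty P] {ω : P → ℤ} (h : IsAlternating ω)
    (hmax : ∀ x, IsMax x → 0 < ω x) : ∃ ω' : WithTop P → ℤ, IsCanonicalLabeling ω' := by
  obtain ⟨x₀, hx₀⟩ := Finite.exists_min ω
  -- This value is negative and below every label, so the extended labeling stays injective.
  set c : ℤ := -|ω x₀| - 1 with hc
  have hc₀ : c < 0 := by have := abs_nonneg (ω x₀); omega
  have hcω : ∀ x, c < ω x := fun x => by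
    have := neg_abs_le (ω x₀)
    have := hx₀ x
    omega
  let ω' : WithTop P → ℤ := fun x => WithTop.recTopCoe (C := fun _ => ℤ) c ω x
  have htop : ω' ⊤ = c := rfl
  have hcoe : ∀ x : P, ω' x = ω x := fun _ => rfl
  have hω' : IsAlternating ω' := by
    refine ⟨fun x y e => ?_, fun x => ?_, fun x hx => ?_, fun x y hxy => ?_⟩
    · induction x <;> induction y <;> simp only [htop, hcoe] at e
      · rfl
      · exact absurd e (hcω _).ne
      · exact absurd e (hcω _).ne'
      · rw [h.injective e]
    · induction x
      · exact hc₀.ne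
      · exact h.ne_zero _
    · induction x
      · exact hc₀
      · exact h.neg_of_isMin _ fun y hy => WithTop.coe_le_coe.1 (hx (WithTop.coe_le_coe.2 hy))
    · induction x
      · exact absurd hxy.1 not_top_lt
      · induction y
        · exact iff_of_false (hmax _ (isMax_of_covBy_top hxy)).not_gt hc₀.not_gt
        · exact h.covBy _ _ ⟨WithTop.coe_lt_coe.1 hxy.1, fun z hz hz' =>
            hxy.2 (WithTop.coe_lt_coe.2 hz) (WithTop.coe_lt_coe.2 hz')⟩
  refine ⟨ω', hω'.isCanonicalLabeling fun x hx => ?_⟩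
  induction x
  · exact hc₀
  · exact absurd (hx le_top) (WithTop.not_top_le_coe _)

end Canonical

/-!
### Linear extensions as words in the poset
-/

section LinearExtensions

variable {P : Type*} [PartialOrder P] [Fintype P]

open Classical in
/-- The linear extensions of `P`, as words in which every element of `P` occurs once. -/
noncomputable def linearExtensions (P : Type*) [PartialOrder P] [Fintype P] : Finset (List P) :=
  (arrangements (Finset.univ : Finset P)).filter fun l => l.Pairwise fun x y => ¬ y < x

theorem mem_linearExtensions {l : List P} : l ∈ linearExtensions P ↔
    l.Nodup ∧ (∀ x, x ∈ l) ∧ l.Pairwise fun x y => ¬ y < x := by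
  classical
  rw [linearExtensions, Finset.mem_filter]
  have : l ∈ @arrangements P (fun a b => Classical.propDecidable _) Finset.univ ↔
      l.Nodup ∧ ∀ x, x ∈ l := by
    rw [mem_arrangements]
    simp
  rw [this, and_assoc]

theorem length_of_mem_linearExtensions {l : List P} (h : l ∈ linearExtensions P) :
    l.length = Fintype.card P := by
  classical
  rw [mem_linearExtensions] at h
  rw [← List.toFinset_card_of_nodup h.1, ← Finset.card_univ]
  congr 1
  ext x
  simp [h.2.1]

/-- Pulling words back to `P` gives a set independent of `ω`, on which different labelings can be
compared. -/
theorem mem_jordanHolderSet {ω : P → ℤ} (hω : Function.Injective ω) {π : List ℤ} :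
    π ∈ jordanHolderSet ω ↔ ∃ l ∈ linearExtensions P, l.map ω = π := by
  classical
  have hidx : ∀ (l : List P) (x : P), (l.map ω).idxOf (ω x) = l.idxOf x := by
    intro l x
    induction l with
    | nil => rfl
    | cons y l ih =>
      by_cases hxy : y = x
      · simp [hxy]
      · have : ω y ≠ ω x := fun e => hxy (hω e)
        rw [List.map_cons, List.idxOf_cons_ne _ this, List.idxOf_cons_ne _ hxy, ih]
  have hpw : ∀ l : List P, l.Nodup → (∀ x, x ∈ l) →
      ((l.Pairwise fun x y => ¬ y < x) ↔ ∀ x y : P, x < y → l.idxOf x < l.idxOf y) := by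
    intro l hnd hall
    constructor
    · intro h x y hxy
      by_contra hlt
      have hlt' : l.idxOf y < l.idxOf x := by
        refine lt_of_le_of_ne (not_lt.1 hlt) fun e => hxy.ne' ?_
        exact (List.idxOf_inj (hall y)).1 e
      have hx := List.idxOf_lt_length_iff.2 (hall x)
      have := List.pairwise_iff_getElem.1 h _ _ (hlt'.trans hx) hx hlt'
      rw [List.getElem_idxOf, List.getElem_idxOf] at this
      exact this hxy
    · intro h
      rw [List.pairwise_iff_getElem]
      intro i j hi hj hij hlt
      have := h _ _ hlt
      rw [hnd.idxOf_getElem, hnd.idxOf_getElem] at this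
      omega
  simp only [jordanHolderSet, Finset.mem_filter, Multiset.mem_toFinset, Multiset.mem_lists_iff]
  rw [Finset.image_val_of_injOn hω.injOn]
  have huniv : ∀ l : List P,
      (Multiset.map ω Finset.univ.val = (l.map ω : List ℤ)) ↔ l.Nodup ∧ ∀ x, x ∈ l := by
    intro l
    rw [← Multiset.map_coe, (Multiset.map_injective hω).eq_iff]
    constructor
    · intro h
      refine ⟨?_, fun x => ?_⟩
      · rw [← Multiset.coe_nodup, ← h]
        exact Finset.univ.nodup
      · rw [← Multiset.mem_coe, ← h]
        exact Finset.mem_univ x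
    · rintro ⟨h₁, h₂⟩
      rw [Multiset.Nodup.ext Finset.univ.nodup (Multiset.coe_nodup.2 h₁)]
      simp [h₂]
  constructor
  · rintro ⟨h₁, h₂⟩
    have h₁ : Multiset.map ω Finset.univ.val = (π : Multiset ℤ) := h₁
    have hπ : ∀ a ∈ π, ∃ x, ω x = a := fun a ha => by
      rw [← Multiset.mem_coe, ← h₁, Multiset.mem_map] at ha
      obtain ⟨x, -, hx⟩ := ha
      exact ⟨x, hx⟩
    obtain ⟨l, rfl⟩ : ∃ l : List P, l.map ω = π := by
      have := Set.range_list_map ω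
      exact this.ge hπ
    have h₃ := (huniv l).1 h₁
    simp only [hidx] at h₂
    exact ⟨l, mem_linearExtensions.2 ⟨h₃.1, h₃.2, (hpw l h₃.1 h₃.2).2 h₂⟩, rfl⟩
  · rintro ⟨l, hl, rfl⟩
    rw [mem_linearExtensions] at hl
    refine ⟨(huniv l).2 ⟨hl.1, hl.2.1⟩, ?_⟩
    simp only [hidx]
    exact (hpw l hl.1 hl.2.1).1 hl.2.2

theorem sum_jordanHolderSet {A : Type*} [AddCommMonoid A] {ω : P → ℤ} (hω : Function.Injective ω)
    (f : List ℤ → A) :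
    ∑ π ∈ jordanHolderSet ω, f π = ∑ l ∈ linearExtensions P, f (l.map ω) := by
  classical
  have : jordanHolderSet ω = (linearExtensions P).image (List.map ω) := by
    ext π
    rw [mem_jordanHolderSet hω, Finset.mem_image]
  rw [this, Finset.sum_image (List.map_injective_iff.2 hω).injOn]

theorem isMin_of_cons_mem {x : P} {l : List P} (h : x :: l ∈ linearExtensions P) : IsMin x := by
  obtain ⟨-, h₂, h₃⟩ := mem_linearExtensions.1 h
  rw [isMin_iff_forall_not_lt]
  intro y hy
  rcases List.mem_cons.1 (h₂ y) with rfl | hm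
  · exact lt_irrefl _ hy
  · exact (List.pairwise_cons.1 h₃).1 y hm hy

theorem isMax_of_append_mem {x : P} {l : List P} (h : l ++ [x] ∈ linearExtensions P) :
    IsMax x := by
  obtain ⟨-, h₂, h₃⟩ := mem_linearExtensions.1 h
  rw [isMax_iff_forall_not_lt]
  intro y hy
  rcases List.mem_append.1 (h₂ y) with hm | hm
  · exact (List.pairwise_append.1 h₃).2.2 y hm x (by simp) hy
  · obtain rfl : y = x := by simpa using hm
    exact lt_irrefl _ hy

/-- If the exchange were illegal, then `x < y`; an element strictly between them would have to stand
between them in the word, so `x ⋖ y` and the signs differ. -/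
theorem IsAlternating.swapClosed {ω : P → ℤ} (h : IsAlternating ω) :
    SwapClosed (fun x => decide (0 < ω x)) (linearExtensions P) := by
  intro s t x y hxy hm
  obtain ⟨h₁, h₂, h₃⟩ := mem_linearExtensions.1 hm
  have hperm : (s ++ x :: y :: t).Perm (s ++ y :: x :: t) :=
    List.Perm.append_left s (List.Perm.swap y x t)
  refine mem_linearExtensions.2 ⟨hperm.nodup_iff.1 h₁, fun z => hperm.mem_iff.1 (h₂ z), ?_⟩
  simp only [List.pairwise_append, List.pairwise_cons, List.mem_cons, forall_eq_or_imp] at h₃ ⊢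
  obtain ⟨hs, ⟨⟨hyx, hxt⟩, hyt, ht⟩, hst⟩ := h₃
  refine ⟨hs, ⟨⟨fun hlt => ?_, hyt⟩, hxt, ht⟩, fun a ha =>
    ⟨(hst a ha).2.1, (hst a ha).1, (hst a ha).2.2⟩⟩
  have hcov : x ⋖ y := by
    refine ⟨hlt, fun z hxz hzy => ?_⟩
    have hz := h₂ z
    simp only [List.mem_append, List.mem_cons] at hz
    rcases hz with hz | rfl | rfl | hz
    · exact (hst z hz).1 hxz
    · exact lt_irrefl _ hxz
    · exact lt_irrefl _ hzy
    · exact hyt z hz hzy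
  have h₄ := h.covBy x y hcov
  have h₅ := h.ne_zero x
  simp only [decide_eq_decide] at hxy
  omega

theorem mem_linearExtensions_withTop {m : List (WithTop P)} : m ∈ linearExtensions (WithTop P) ↔
    ∃ l ∈ linearExtensions P, l.map (fun x : P => (x : WithTop P)) ++ [⊤] = m := by
  have hpw : ∀ l : List P, (l.map (fun x : P => (x : WithTop P))).Pairwise (fun x y => ¬ y < x) ↔
      l.Pairwise fun x y => ¬ y < x := by
    intro l
    rw [List.pairwise_map]
    simp only [WithTop.coe_lt_coe]
  have hnd : ∀ l : List P, (l.map (fun x : P => (x : WithTop P))).Nodup ↔ l.Nodup := fun l =>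
    List.nodup_map_iff WithTop.coe_injective
  constructor
  · intro hm
    obtain ⟨h₁, h₂, h₃⟩ := mem_linearExtensions.1 hm
    rcases List.eq_nil_or_concat m with rfl | ⟨m, z, rfl⟩
    · simpa using h₂ ⊤
    rw [List.concat_eq_append] at *
    obtain rfl : z = ⊤ := (isMax_of_append_mem hm).eq_top
    rw [List.nodup_append] at h₁
    obtain ⟨l, rfl⟩ : ∃ l : List P, l.map (fun x : P => (x : WithTop P)) = m :=
      CanLift.prf (β := List P) m fun a ha => h₁.2.2 a ha ⊤ (by simp)
    refine ⟨l, mem_linearExtensions.2 ⟨(hnd l).1 h₁.1, fun x => ?_,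
      (hpw l).1 (List.pairwise_append.1 h₃).1⟩, rfl⟩
    simpa using h₂ x
  · rintro ⟨l, hl, rfl⟩
    obtain ⟨h₁, h₂, h₃⟩ := mem_linearExtensions.1 hl
    refine mem_linearExtensions.2 ⟨?_, fun x => ?_, ?_⟩
    · rw [List.nodup_append]
      refine ⟨(hnd l).2 h₁, by simp, ?_⟩
      simp
    · induction x <;> simp [h₂]
    · rw [List.pairwise_append]
      refine ⟨(hpw l).2 h₃, by simp, ?_⟩
      simp

theorem sum_linearExtensions_withTop {A : Type*} [AddCommMonoid A] (f : List (WithTop P) → A) :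
    ∑ m ∈ linearExtensions (WithTop P), f m =
      ∑ l ∈ linearExtensions P, f (l.map (fun x : P => (x : WithTop P)) ++ [⊤]) := by
  classical
  have : linearExtensions (WithTop P) = (linearExtensions P).image
      fun l => l.map (fun x : P => (x : WithTop P)) ++ [⊤] := by
    ext m
    rw [mem_linearExtensions_withTop, Finset.mem_image]
  rw [this, Finset.sum_image]
  intro l _ l' _ e
  exact List.map_injective_iff.2 WithTop.coe_injective (List.append_cancel_right e)

end LinearExtensions

/-!
### The expansion of the Eulerian polynomial
-/

section Expansion

variable {P : Type*} [PartialOrder P] [Fintype P]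

/-- The word `a₁ ⋯ a_p` of a linear extension, bordered by zeros. -/
def borderedWord (ω : P → ℤ) (l : List P) : List ℤ := 0 :: (l.map ω ++ [0])

/-- The first letter is minimal, hence negative; the last is maximal, hence positive exactly when `e
= 1`. So valleys exceed peaks by `1 - e`, and the step to the final zero adds `e` descents. -/
theorem IsAlternating.word_statistics [Nonempty P] {ω : P → ℤ} (h : IsAlternating ω) {e : ℕ}
    (hmax : ∀ x, IsMax x → e = if 0 < ω x then 1 else 0) {l : List P}
    (hl : l ∈ linearExtensions P) :
    2 * innerPeakCount (borderedWord ω l) + 1 + doubleAscentCount (borderedWord ω l) +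
        doubleDescentCount (borderedWord ω l) = Fintype.card P + e ∧
      innerPeakCount (borderedWord ω l) + doubleDescentCount (borderedWord ω l) =
        descentCount (l.map ω) + e := by
  obtain ⟨hnd, hall, -⟩ := mem_linearExtensions.1 hl
  have hlen := length_of_mem_linearExtensions hl
  rcases l with _ | ⟨x, l⟩
  · obtain ⟨x⟩ := ‹Nonempty P›
    simpa using hall x
  have hx := h.neg_of_isMin x (isMin_of_cons_mem hl)
  obtain ⟨m, z, hm⟩ : ∃ m z, x :: l = m ++ [z] :=
    ⟨_, _, (List.dropLast_append_getLast (List.cons_ne_nil x l)).symm⟩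
  have hz := hmax z (isMax_of_append_mem (hm ▸ hl))
  have hz₀ := h.ne_zero z
  have hlast : (ω x :: l.map ω).getLast (List.cons_ne_nil _ _) = ω z := by
    have : ω x :: l.map ω = m.map ω ++ [ω z] := by simpa using congrArg (List.map ω) hm
    simp [this]
  have hnd' : (ω x :: l.map ω).Nodup := by
    simpa using hnd.map h.injective
  have h0 : (0 : ℤ) ∉ ω x :: l.map ω := by
    rw [← List.map_cons, List.mem_map]
    rintro ⟨y, -, hy⟩
    exact h.ne_zero y hy
  have e₁ := innerValleyCount_add_first 0 (ω x) (ω z) (l.map ω) hnd' h0 hlast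
  have e₂ := descentCount_append_zero (ω x) (ω z) (l.map ω) hlast
  have e₃ := innerPeakCount_add_doubleDescentCount 0 ((ω x :: l.map ω) ++ [0])
  have e₄ := innerCount_total 0 (ω x) (l.map ω ++ [0])
  rw [← hlen]
  simp only [borderedWord, List.map_cons, List.cons_append, List.length_append, List.length_map,
    List.length_cons, List.length_nil] at e₁ e₂ e₃ e₄ ⊢
  split_ifs at hz e₁ e₂ <;> omega

theorem peakPoly_eq {ω : P → ℤ} (hω : Function.Injective ω) :
    peakPoly ω = ∑ l ∈ linearExtensions P, wordWeight (X : ℤ[X]) 1 1 1 (l.map ω) := by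
  rw [peakPoly, sum_jordanHolderSet hω]
  refine Finset.sum_congr rfl fun l _ => ?_
  rw [wordWeight, innerWeight_eq, peakCount]
  simp

theorem IsAlternating.X_pow_mul_eulerianPoly [Nonempty P] {ω : P → ℤ} (h : IsAlternating ω)
    {e : ℕ} (hmax : ∀ x, IsMax x → e = if 0 < ω x then 1 else 0) :
    X ^ e * eulerianPoly ω =
      ∑ l ∈ linearExtensions P, wordWeight (X : ℤ[X]) 1 1 X (l.map ω) := by
  rw [eulerianPoly, sum_jordanHolderSet h.injective, Finset.mul_sum]
  refine Finset.sum_congr rfl fun l hl => ?_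
  have := (h.word_statistics hmax hl).2
  rw [wordWeight, innerWeight_eq]
  rw [borderedWord] at this
  simp only [one_pow, mul_one]
  rw [← pow_add, ← pow_add, this, add_comm]

theorem coeff_peakPoly (ω : P → ℤ) (i : ℕ) : (peakPoly ω).coeff i = numWithPeaks ω i := by
  simp [peakPoly, numWithPeaks, coeff_X_pow, eq_comm]

/-- The number of linear extensions whose words have `i + e` peaks and no double descent. -/
noncomputable def gammaCoeff (ω : P → ℤ) (e i : ℕ) : ℕ :=
  ((linearExtensions P).filter fun l => doubleDescentCount (borderedWord ω l) = 0 ∧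
    innerPeakCount (borderedWord ω l) = i + e).card

theorem IsAlternating.sum_wordWeight_zero [Nonempty P] {ω : P → ℤ} (h : IsAlternating ω)
    {e : ℕ} (hmax : ∀ x, IsMax x → e = if 0 < ω x then 1 else 0) (c : ℤ[X]) {d : ℕ}
    (hd : d + e + 1 = Fintype.card P) :
    ∑ l ∈ linearExtensions P, wordWeight X 1 c 0 (l.map ω) =
      ∑ i ∈ Finset.range (d / 2 + 1), C (gammaCoeff ω e i : ℤ) * X ^ (i + e) * c ^ (d - 2 * i) := by
  have h₁ : ∀ l : List P, wordWeight X 1 c 0 (l.map ω) =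
      if doubleDescentCount (borderedWord ω l) = 0 then
        X ^ innerPeakCount (borderedWord ω l) * c ^ doubleAscentCount (borderedWord ω l) else 0 := by
    intro l
    rw [wordWeight, innerWeight_eq, ← borderedWord]
    split_ifs with h₀ <;> simp [h₀]
  simp only [h₁]
  rw [← Finset.sum_filter]
  -- The subtraction is not truncated: without double descents, the number of peaks is the number of
  -- descents plus `e`.
  have hstat : ∀ l ∈ (linearExtensions P).filter
      fun l => doubleDescentCount (borderedWord ω l) = 0, ∀ i,
      innerPeakCount (borderedWord ω l) - e = i → innerPeakCount (borderedWord ω l) = i + e ∧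
        doubleAscentCount (borderedWord ω l) = d - 2 * i ∧ 2 * i ≤ d := by
    intro l hl i hi
    rw [Finset.mem_filter] at hl
    have := h.word_statistics hmax hl.1
    omega
  rw [← Finset.sum_fiberwise_of_maps_to (t := Finset.range (d / 2 + 1))
    (g := fun l => innerPeakCount (borderedWord ω l) - e)]
  · refine Finset.sum_congr rfl fun i _ => ?_
    rw [Finset.sum_congr rfl (g := fun _ => X ^ (i + e) * c ^ (d - 2 * i))]
    · rw [Finset.sum_const, nsmul_eq_mul, gammaCoeff, Finset.filter_filter, mul_assoc]
      congr 1
      have : (linearExtensions P).filter (fun l => doubleDescentCount (borderedWord ω l) = 0 ∧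
          innerPeakCount (borderedWord ω l) - e = i) = (linearExtensions P).filter
          fun l => doubleDescentCount (borderedWord ω l) = 0 ∧
            innerPeakCount (borderedWord ω l) = i + e := by
        refine Finset.filter_congr fun l hl => ?_
        constructor
        · rintro ⟨h₂, h₃⟩
          exact ⟨h₂, (hstat l (Finset.mem_filter.2 ⟨hl, h₂⟩) i h₃).1⟩
        · rintro ⟨h₂, h₃⟩
          exact ⟨h₂, by omega⟩
      rw [this]
      simp
    · intro l hl
      rw [Finset.mem_filter] at hl
      obtain ⟨h₂, h₃, -⟩ := hstat l hl.1 i hl.2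
      rw [h₂, h₃]
  · intro l hl
    have := (hstat l hl _ rfl).2.2
    rw [Finset.mem_range]
    omega

theorem IsAlternating.sum_wordWeight_congr {A : Type*} [CommRing A] {ω ω' : P → ℤ}
    (h : IsAlternating ω) (h' : IsAlternating ω') (p q u v u' v' : A) (huv : u + v = u' + v') :
    ∑ l ∈ linearExtensions P, wordWeight p q u v (l.map ω) =
      ∑ l ∈ linearExtensions P, wordWeight p q u' v' (l.map ω') := by
  classical
  exact h.swapClosed.sum_wordWeight_congr (fun l hl => (mem_linearExtensions.1 hl).1) p q u v u' v'
    huv ω ω' h.injective h'.injective (h.hasSign fun _ => Iff.rfl) (h'.hasSign (h.pos_iff h'))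

theorem IsAlternating.peakPoly_congr {ω ω' : P → ℤ} (h : IsAlternating ω)
    (h' : IsAlternating ω') : peakPoly ω = peakPoly ω' := by
  rw [peakPoly_eq h.injective, peakPoly_eq h'.injective]
  exact h.sum_wordWeight_congr h' _ _ _ _ _ _ rfl

/-- The weights `u = 1`, `v = X` are traded for `1 + X`, 0. -/
theorem IsAlternating.eulerianPoly_eq [Nonempty P] {ω : P → ℤ} (h : IsAlternating ω) {e : ℕ}
    (hmax : ∀ x, IsMax x → e = if 0 < ω x then 1 else 0) {d : ℕ}
    (hd : d + e + 1 = Fintype.card P) :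
    eulerianPoly ω = ∑ i ∈ Finset.range (d / 2 + 1),
      C (gammaCoeff ω e i : ℤ) * X ^ i * (1 + X) ^ (d - 2 * i) := by
  have hX : (X : ℤ[X]) ^ e ≠ 0 := pow_ne_zero _ X_ne_zero
  refine mul_left_cancel₀ hX ?_
  rw [h.X_pow_mul_eulerianPoly hmax,
    h.sum_wordWeight_congr h X 1 1 X (1 + X) 0 (by ring), h.sum_wordWeight_zero hmax _ hd,
    Finset.mul_sum]
  refine Finset.sum_congr rfl fun i _ => ?_
  rw [pow_add]
  ring

/-- The weights `u = v = 1` are traded for 2, 0, so the coefficients of the Eulerian expansion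
reappear. -/
theorem IsAlternating.peakPoly_eq_sum [Nonempty P] {ω : P → ℤ} (h : IsAlternating ω) {e : ℕ}
    (hmax : ∀ x, IsMax x → e = if 0 < ω x then 1 else 0) {d : ℕ}
    (hd : d + e + 1 = Fintype.card P) :
    peakPoly ω = ∑ i ∈ Finset.range (d / 2 + 1),
      C ((gammaCoeff ω e i : ℤ) * 2 ^ (d - 2 * i)) * X ^ (i + e) := by
  rw [peakPoly_eq h.injective, h.sum_wordWeight_congr h X 1 1 1 2 0 (by norm_num),
    h.sum_wordWeight_zero hmax _ hd]
  refine Finset.sum_congr rfl fun i _ => ?_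
  rw [C_mul, C_pow, show (C (2 : ℤ) : ℤ[X]) = 2 from rfl]
  ring

theorem IsAlternating.numWithPeaks_eq [Nonempty P] {ω : P → ℤ} (h : IsAlternating ω) {e : ℕ}
    (hmax : ∀ x, IsMax x → e = if 0 < ω x then 1 else 0) {d : ℕ}
    (hd : d + e + 1 = Fintype.card P) {i : ℕ} (hi : i ≤ d / 2) :
    numWithPeaks ω (i + e) = gammaCoeff ω e i * 2 ^ (d - 2 * i) := by
  have := coeff_peakPoly ω (i + e)
  rw [h.peakPoly_eq_sum hmax hd, finsetSum_coeff] at this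
  simp only [coeff_C_mul, coeff_X_pow, add_left_inj] at this
  rw [Finset.sum_eq_single i (by intro j _ hj; simp [hj.symm])
    (by intro h; exact absurd (Finset.mem_range.2 (by omega)) h)] at this
  simp only [if_true, mul_one] at this
  exact_mod_cast this.symm

/-- Both expansions match term by term: `4 * t / (1 + t) ^ 2` to the power `i + e` supplies the
missing `2 ^ (2 * i + 2 * e)`, whence the exponent `d + 2 * e`. -/
theorem IsAlternating.aeval_eulerianPoly [Nonempty P] {ω : P → ℤ} (h : IsAlternating ω) {e : ℕ}
    (hmax : ∀ x, IsMax x → e = if 0 < ω x then 1 else 0) {d : ℕ}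
    (hd : d + e + 1 = Fintype.card P) {K : Type*} [Field K] [CharZero K] (t : K)
    (ht : 1 + t ≠ 0) :
    2 ^ (d + 2 * e) * t ^ e * aeval t (eulerianPoly ω) =
      (1 + t) ^ (d + 2 * e) * aeval (4 * t / (1 + t) ^ 2) (peakPoly ω) := by
  rw [h.eulerianPoly_eq hmax hd, h.peakPoly_eq_sum hmax hd, map_sum, map_sum, Finset.mul_sum,
    Finset.mul_sum]
  refine Finset.sum_congr rfl fun i hi => ?_
  have hi : 2 * i ≤ d := by
    rw [Finset.mem_range] at hi
    omega
  obtain ⟨k, rfl⟩ := Nat.exists_eq_add_of_le hi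
  simp only [map_mul, map_pow, map_add, map_one, aeval_X, map_natCast, map_ofNat]
  rw [Nat.add_sub_cancel_left, div_pow, mul_pow, show (4 : K) = 2 ^ 2 by norm_num, ← pow_mul,
    ← pow_mul]
  field_simp
  ring

/-- The system is triangular: the `i`-th basis polynomial has lowest term `X ^ i` with coefficient
1. -/
theorem coeff_unique {d : ℕ} {a b : ℕ → ℤ}
    (h : ∑ i ∈ Finset.range (d / 2 + 1), C (a i) * X ^ i * (1 + X) ^ (d - 2 * i) =
      ∑ i ∈ Finset.range (d / 2 + 1), C (b i) * X ^ i * (1 + X) ^ (d - 2 * i)) {i : ℕ}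
    (hi : i ≤ d / 2) : a i = b i := by
  induction i using Nat.strong_induction_on with
  | _ i ih =>
  have h₀ : ∑ j ∈ Finset.range (d / 2 + 1), C (a j - b j) * X ^ j * (1 + X : ℤ[X]) ^ (d - 2 * j) =
      0 := by
    simp only [C_sub, sub_mul, Finset.sum_sub_distrib]
    exact sub_eq_zero.2 h
  have h₁ := congrArg (fun f => coeff f i) h₀
  simp only [finsetSum_coeff, coeff_zero] at h₁
  rw [Finset.sum_eq_single i] at h₁
  · rw [mul_assoc, coeff_C_mul, coeff_X_pow_mul', if_pos le_rfl, Nat.sub_self,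
      coeff_zero_eq_eval_zero] at h₁
    simp only [eval_pow, eval_add, eval_one, eval_X, add_zero, one_pow, mul_one] at h₁
    omega
  · intro j _ hj
    rcases lt_or_gt_of_ne hj with hj | hj
    · rw [ih j hj (by omega), sub_self, C_0, zero_mul, zero_mul, coeff_zero]
    · rw [mul_assoc, coeff_C_mul, coeff_X_pow_mul', if_neg (by omega), mul_zero]
  · intro hi'
    exact absurd (Finset.mem_range.2 (by omega)) hi'

/-- Either way `a` is followed by something smaller, and `b` is a valley. -/
theorem innerPeakCount_append_neg {a b : ℤ} (ha : 0 < a) (hb : b < 0) : ∀ w : List ℤ,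
    innerPeakCount (w ++ [a, b, 0]) = innerPeakCount (w ++ [a, 0])
  | [] => by simp [innerPeakCount]; omega
  | [x] => by simp [innerPeakCount, ha, hb.trans ha]; omega
  | [x, y] => by
      have := innerPeakCount_append_neg ha hb [y]
      simp only [List.cons_append, List.nil_append, innerPeakCount] at this ⊢
      omega
  | x :: y :: z :: w => by
      have := innerPeakCount_append_neg ha hb (y :: z :: w)
      simp only [List.cons_append, innerPeakCount] at this ⊢
      omega

theorem IsAlternating.peakPoly_withTop [Nonempty P] {ω : WithTop P → ℤ} (h : IsAlternating ω)
    (hmax : ∀ x : P, IsMax x → 0 < ω x) : peakPoly ω = peakPoly fun x : P => ω x := by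
  rw [peakPoly, peakPoly, sum_jordanHolderSet h.injective,
    sum_jordanHolderSet h.comp_coe.injective, sum_linearExtensions_withTop]
  refine Finset.sum_congr rfl fun l hl => ?_
  rcases List.eq_nil_or_concat l with rfl | ⟨m, z, rfl⟩
  · obtain ⟨x⟩ := ‹Nonempty P›
    simpa using (mem_linearExtensions.1 hl).2.1 x
  rw [List.concat_eq_append] at *
  have hzm := isMax_of_append_mem hl
  have hz := hmax z hzm
  have hcov : (z : WithTop P) ⋖ ⊤ := by
    refine ⟨WithTop.coe_lt_top z, fun y hy hy' => ?_⟩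
    induction y
    · exact lt_irrefl _ hy'
    · exact hzm.not_lt (WithTop.coe_lt_coe.1 hy)
  have htop : ω ⊤ < 0 := by
    have := h.covBy _ _ hcov
    have := h.ne_zero ⊤
    omega
  have := innerPeakCount_append_neg hz htop (0 :: m.map fun x : P => ω x)
  rw [peakCount, peakCount]
  congr 1
  simpa [Function.comp_def] using this

theorem exists_isMin_of_finite (P : Type*) [PartialOrder P] [Finite P] [Nonempty P] :
    ∃ x : P, IsMin x := by
  obtain ⟨x, -, hx⟩ := Set.finite_univ.exists_le_minimal (Set.mem_univ (Classical.arbitrary P))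
  exact ⟨x, by simpa using hx⟩

theorem exists_isMax_of_finite (P : Type*) [PartialOrder P] [Finite P] [Nonempty P] :
    ∃ x : P, IsMax x :=
  exists_isMin_of_finite Pᵒᵈ

/-- Keeps `eulerianDegree` from being truncated. For `e = 1` a minimal and a maximal element have
opposite signs, so they differ. -/
theorem IsAlternating.lt_card [Nonempty P] {ω : P → ℤ} (h : IsAlternating ω) {e : ℕ}
    (hmax : ∀ x, IsMax x → e = if 0 < ω x then 1 else 0) : e < Fintype.card P := by
  obtain ⟨a, ha'⟩ := exists_isMin_of_finite P
  obtain ⟨b, hb'⟩ := exists_isMax_of_finite P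
  have := hmax b hb'
  have hpos : 0 < Fintype.card P := Fintype.card_pos
  split_ifs at this with h₀
  · have hab : a ≠ b := by
      rintro rfl
      exact (h.neg_of_isMin a ha').not_gt h₀
    rw [this]
    exact Fintype.one_lt_card_iff.2 ⟨a, b, hab⟩
  · omega

end Expansion

/-- Uniqueness is contained in the coefficient formulas, which hold for every expansion `a`. The
rational function identities are stated pointwise over a field of characteristic zero, away from
their poles. -/
theorem mainTheorem9 {P : Type*} [PartialOrder P] [Fintype P] [Nonempty P]
    (ω : P → ℤ) (hω : IsCanonicalLabeling ω) (r : ℤ) (hr : IsSignGradedOfRank ω r)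
    (K : Type*) [Field K] [CharZero K] :
    (r = 0 ∨ r = 1) ∧
    (∃ a : ℕ → ℕ, IsEulerianExpansion ω r (fun i => (a i : ℤ))) ∧
    (r = 0 →
      (∀ t : K, 1 + t ≠ 0 →
        aeval t (eulerianPoly ω) =
          (2 : K) ^ (-(Fintype.card P : ℤ) + 1) * (1 + t) ^ ((Fintype.card P : ℤ) - 1) *
            aeval (4 * t / (1 + t) ^ 2) (peakPoly ω)) ∧
      (∀ a : ℕ → ℤ, IsEulerianExpansion ω r a → ∀ i ≤ eulerianDegree P r / 2,
        (a i : ℚ) = (2 : ℚ) ^ (-(Fintype.card P : ℤ) + 1 + 2 * (i : ℤ)) *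
          (numWithPeaks ω i : ℚ))) ∧
    (r = 1 →
      (∃ ω' : WithTop P → ℤ, IsCanonicalLabeling ω') ∧
      ∀ ω' : WithTop P → ℤ, IsCanonicalLabeling ω' →
        (∀ t : K, t ≠ 0 → 1 + t ≠ 0 →
          aeval t (eulerianPoly ω) =
            (2 : K) ^ (-(Fintype.card P : ℤ)) * t⁻¹ * (1 + t) ^ (Fintype.card P : ℤ) *
              aeval (4 * t / (1 + t) ^ 2) (peakPoly ω')) ∧
        (∀ a : ℕ → ℤ, IsEulerianExpansion ω r a → ∀ i ≤ eulerianDegree P r / 2,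
          (a i : ℚ) = (2 : ℚ) ^ (-(Fintype.card P : ℤ) + 2 + 2 * (i : ℤ)) *
            (numWithPeaks ω' (i + 1) : ℚ))) := by
  have h := hω.isAlternating
  obtain ⟨b, hb⟩ := exists_isMax_of_finite P
  have hrank := h.rank_eq hr
  obtain ⟨e, he, hre⟩ : ∃ e : ℕ, e ≤ 1 ∧ r = e := by
    rw [hrank b hb]
    split_ifs
    · exact ⟨1, le_rfl, rfl⟩
    · exact ⟨0, zero_le_one, rfl⟩
  subst hre
  have hmax : ∀ x, IsMax x → e = if 0 < ω x then 1 else 0 := fun x hx => by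
    have := hrank x hx
    split_ifs at this ⊢ <;> omega
  have hlt := h.lt_card hmax
  have hdeg : eulerianDegree P e + e + 1 = Fintype.card P := by
    rw [eulerianDegree]
    omega
  have hexp : IsEulerianExpansion ω e fun i => (gammaCoeff ω e i : ℤ) := h.eulerianPoly_eq hmax hdeg
  -- One formula serves both ranks, since `d = p - e - 1`.
  have hcoeff : ∀ a : ℕ → ℤ, IsEulerianExpansion ω e a → ∀ i ≤ eulerianDegree P e / 2,
      (a i : ℚ) = (2 : ℚ) ^ (-(eulerianDegree P e : ℤ) + 2 * (i : ℤ)) *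
        (numWithPeaks ω (i + e) : ℚ) := by
    intro a ha i hi
    have h₁ : a i = gammaCoeff ω e i := coeff_unique (ha.symm.trans hexp) hi
    have h₂ : (-(eulerianDegree P e : ℤ) + 2 * (i : ℤ)) = -((eulerianDegree P e - 2 * i : ℕ) : ℤ) := by
      omega
    rw [h₁, h.numWithPeaks_eq hmax hdeg hi, h₂, zpow_neg, zpow_natCast]
    push_cast
    field_simp
  refine ⟨by omega, ⟨_, hexp⟩, fun h0 => ?_, fun h1 => ?_⟩
  · obtain rfl : e = 0 := by omega
    refine ⟨fun t ht => ?_, fun a ha i hi => ?_⟩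
    · have := h.aeval_eulerianPoly hmax hdeg t ht
      have e₁ : -(Fintype.card P : ℤ) + 1 = -(eulerianDegree P (0 : ℕ) : ℤ) := by omega
      have e₂ : (Fintype.card P : ℤ) - 1 = (eulerianDegree P (0 : ℕ) : ℤ) := by omega
      rw [e₁, e₂, zpow_neg, zpow_natCast, zpow_natCast, mul_assoc, eq_inv_mul_iff_mul_eq₀
        (pow_ne_zero _ two_ne_zero)]
      simpa using this
    · rw [hcoeff a ha i hi, add_zero]
      congr 2
      omega
  · obtain rfl : e = 1 := by omega
    have hpos : ∀ x, IsMax x → 0 < ω x := fun x hx => by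
      have := hmax x hx
      split_ifs at this with h₀
      exact h₀
    refine ⟨h.exists_withTop hpos, fun ω' hω' => ?_⟩
    have h' := hω'.isAlternating
    -- Dropping the greatest element leaves a possibly different alternating labeling of `P`, but
    -- the peak polynomial depends only on its signs.
    have hpeak : peakPoly ω' = peakPoly ω := by
      rw [h'.peakPoly_withTop fun x hx => (h.pos_iff h'.comp_coe x).1 (hpos x hx)]
      exact h'.comp_coe.peakPoly_congr h
    refine ⟨fun t ht₀ ht => ?_, fun a ha i hi => ?_⟩
    · have := h.aeval_eulerianPoly hmax hdeg t ht
      have e₁ : eulerianDegree P (1 : ℕ) + 2 * 1 = Fintype.card P := by omega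
      rw [e₁, pow_one] at this
      rw [hpeak, zpow_neg, zpow_natCast, zpow_natCast, mul_assoc, ← this]
      field_simp
    · have hnum : numWithPeaks ω' (i + 1) = numWithPeaks ω (i + 1) := by
        have := congrArg (fun f => coeff f (i + 1)) hpeak
        simp only [coeff_peakPoly] at this
        exact_mod_cast this
      rw [hcoeff a ha i hi, hnum]
      congr 2
      omega
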